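/- Let $K\subseteq\mathbb{R}^n$ be a nonempty closed convex cone ($K=\lambda K$ for every $\lambda>0$), let $A\in\mathbb{R}^{m\times n}$ with $m\le n$ have full rank $m$, and let $b\in\mathbb{R}^m$. Write $\|\cdot\|$ for the Euclidean norm, $P_C$ for the Euclidean projection onto a nonempty closed convex set $C$, $R_C=2P_C-I$ for the reflection, $K^*=\{u\mid u^Tx\ge 0\text{ for all }x\in K\}$, $\mathcal N(A)$ for the null space of $A$ and $\mathcal R(A^T)$ for the range of $A^T$. The conic program (P) with constraints $Ax=b$, $x\in K$ is called strongly infeasible if $K\cap\{x\mid Ax=b\}=\emptyset$ and $\inf\{\|x-y\| \mid x\in K,\ Ay=b\}>0$. Put $$x_0=A^T(AA^T)^{-1}b,\qquad T_2(z)=\tfrac12\bigl(I+R_{\mathcal N(A)}R_K\bigr)(z)+x_0,$$ and let $v=P_{\overline{\operatorname{ran}(I-T_2)}}(0)$ be the infimal displacement vector of $T_2$, where $\operatorname{ran}(I-T_2)=\{z-T_2(z)\mid z\in\mathbb{R}^n\}$ (its closure is convex). **Theorem (Separating hyperplane).** Consider the iteration $z^{k+1}=T_2(z^k)$ with any starting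 point $z^0\in\mathbb{R}^n$. Then $z^k-z^{k+1}\to v$, and (P) is strongly infeasible if and only if $v\neq 0$. Set $h=-v$ and $\beta=-(v^Tx_0)/2$. Then $h\in -(K^*\cap\mathcal R(A^T))$, that is, $v\in K^*\cap\mathcal R(A^T)$. If (P) is strongly infeasible, then $\beta>0$ and the hyperplane $\{x\mid h^Tx=\beta\}$ strictly separates $K$ and $\{x\mid Ax=b\}$: for all $y_1\in K$ and all $y_2$ with $Ay_2=b$, $$h^Ty_1<\beta<h^Ty_2 .$$ -/

import Mathlib

open Filter Topology

namespace ConicDRS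

/-- `K = t K` for every `t > 0`. -/
def IsCone {n : ℕ} (K : Set (EuclideanSpace ℝ (Fin n))) : Prop :=
  ∀ t : ℝ, 0 < t → (fun x => t • x) '' K = K

/-- The dual cone `{u | uᵀ x ≥ 0 for all x ∈ K}`. -/
def dualCone {n : ℕ} (K : Set (EuclideanSpace ℝ (Fin n))) : Set (EuclideanSpace ℝ (Fin n)) :=
  {u | ∀ x ∈ K, 0 ≤ inner ℝ u x}

/-- The affine set `{x | A x = b}`. -/
def affineSet {m n : ℕ} (A : Matrix (Fin m) (Fin n) ℝ) (b : EuclideanSpace ℝ (Fin m)) :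
    Set (EuclideanSpace ℝ (Fin n)) :=
  {x | A.mulVec x.ofLp = b.ofLp}

/-- The null space of `A`. -/
def nullSpace {m n : ℕ} (A : Matrix (Fin m) (Fin n) ℝ) : Set (EuclideanSpace ℝ (Fin n)) :=
  {x | A.mulVec x.ofLp = 0}

/-- The range of `Aᵀ`. -/
def rangeTranspose {m n : ℕ} (A : Matrix (Fin m) (Fin n) ℝ) : Set (EuclideanSpace ℝ (Fin n)) :=
  {x | ∃ w : Fin m → ℝ, A.transpose.mulVec w = x.ofLp}

/-- The distance `inf {‖x - y‖ | x ∈ C₁, y ∈ C₂}` between two sets. -/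
noncomputable def setDist {n : ℕ} (C₁ C₂ : Set (EuclideanSpace ℝ (Fin n))) : ℝ :=
  sInf {r | ∃ x ∈ C₁, ∃ y ∈ C₂, r = ‖x - y‖}

/-- The conic program with constraints `A x = b`, `x ∈ K` is strongly infeasible: it is infeasible
and the distance between `K` and `{x | A x = b}` is positive. -/
def IsStronglyInfeasible {m n : ℕ} (K : Set (EuclideanSpace ℝ (Fin n)))
    (A : Matrix (Fin m) (Fin n) ℝ) (b : EuclideanSpace ℝ (Fin m)) : Prop :=
  K ∩ affineSet A b = ∅ ∧ 0 < setDist K (affineSet A b)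

/-- `p` minimizes `‖y - x‖` over `y ∈ C`. -/
def IsNearestPoint {n : ℕ} (C : Set (EuclideanSpace ℝ (Fin n)))
    (x p : EuclideanSpace ℝ (Fin n)) : Prop :=
  p ∈ C ∧ ∀ y ∈ C, ‖p - x‖ ≤ ‖y - x‖

/-- The Euclidean projection `P_C x` (see `isNearestPoint_proj` and `IsNearestPoint.eq_proj`). -/
noncomputable def proj {n : ℕ} (C : Set (EuclideanSpace ℝ (Fin n)))
    (x : EuclideanSpace ℝ (Fin n)) : EuclideanSpace ℝ (Fin n) :=
  Classical.epsilon (IsNearestPoint C x)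

theorem isNearestPoint_proj {n : ℕ} {C : Set (EuclideanSpace ℝ (Fin n))} (hne : C.Nonempty)
    (hC : IsClosed C) (x : EuclideanSpace ℝ (Fin n)) : IsNearestPoint C x (proj C x) := by
  obtain ⟨p, hp, h⟩ := hC.exists_infDist_eq_dist hne x
  refine Classical.epsilon_spec (p := IsNearestPoint C x) ⟨p, hp, fun y hy => ?_⟩
  rw [← dist_eq_norm, ← dist_eq_norm, dist_comm p, dist_comm y, ← h]
  exact Metric.infDist_le_dist_of_mem hy

theorem IsNearestPoint.eq_proj {n : ℕ} {C : Set (EuclideanSpace ℝ (Fin n))} (hC : IsClosed C)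
    (hconv : Convex ℝ C) {x p : EuclideanSpace ℝ (Fin n)} (hp : IsNearestPoint C x p) :
    p = proj C x := by
  have hq := isNearestPoint_proj ⟨p, hp.1⟩ hC x
  set q := proj C x
  have hm := hp.2 _ (hconv hp.1 hq.1 (by norm_num : (0 : ℝ) ≤ 1 / 2)
    (by norm_num : (0 : ℝ) ≤ 1 / 2) (by norm_num))
  have he : ‖q - x‖ = ‖p - x‖ := le_antisymm (hq.2 p hp.1) (hp.2 q hq.1)
  have hpar := parallelogram_law_with_norm ℝ (p - x) (q - x)
  have h1 : (p - x) + (q - x) = (2 : ℝ) • ((1 / 2 : ℝ) • p + (1 / 2 : ℝ) • q - x) := by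
    module
  have h2 : (p - x) - (q - x) = p - q := by abel
  rw [h1, h2, norm_smul, he, Real.norm_ofNat] at hpar
  have h3 : ‖p - q‖ = 0 := by
    nlinarith [norm_nonneg (p - q), norm_nonneg (p - x)]
  exact sub_eq_zero.mp (norm_eq_zero.mp h3)

/-- The reflection `R_C x = 2 P_C x - x`. -/
noncomputable def refl {n : ℕ} (C : Set (EuclideanSpace ℝ (Fin n)))
    (x : EuclideanSpace ℝ (Fin n)) : EuclideanSpace ℝ (Fin n) :=
  (2 : ℝ) • proj C x - x

/-- The vector `x₀ = Aᵀ (A Aᵀ)⁻¹ b`. -/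
noncomputable def x0 {m n : ℕ} (A : Matrix (Fin m) (Fin n) ℝ) (b : EuclideanSpace ℝ (Fin m)) :
    EuclideanSpace ℝ (Fin n) :=
  WithLp.toLp 2 ((A.transpose * (A * A.transpose)⁻¹).mulVec b.ofLp)

/-- The operator `½ (I + R_{N(A)} R_K)`. -/
noncomputable def Ttilde {m n : ℕ} (K : Set (EuclideanSpace ℝ (Fin n)))
    (A : Matrix (Fin m) (Fin n) ℝ) (z : EuclideanSpace ℝ (Fin n)) : EuclideanSpace ℝ (Fin n) :=
  (1 / 2 : ℝ) • (z + refl (nullSpace A) (refl K z))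

/-- The operator `T₂ z = ½ (I + R_{N(A)} R_K) z + x₀`. -/
noncomputable def T2 {m n : ℕ} (K : Set (EuclideanSpace ℝ (Fin n)))
    (A : Matrix (Fin m) (Fin n) ℝ) (b : EuclideanSpace ℝ (Fin m))
    (z : EuclideanSpace ℝ (Fin n)) : EuclideanSpace ℝ (Fin n) :=
  Ttilde K A z + x0 A b

/-- The infimal displacement vector of `T`: the projection of the origin onto the closure of the
range of `I - T`. -/
noncomputable def infimalDisplacement {n : ℕ}
    (T : EuclideanSpace ℝ (Fin n) → EuclideanSpace ℝ (Fin n)) : EuclideanSpace ℝ (Fin n) :=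
  proj (closure (Set.range fun x => x - T x)) 0

end ConicDRS

/-!
Write `N` for the null space of `A`, `P` for the projection onto `N` and `Q = I - P` for the
projection onto `Nᗮ = R(Aᵀ)`. With `p = P_K z` and `q = z - p`, the displacement of the operator is
`z - T₂ z = Q p + P q - x₀`, and `T₂ z = P p + Q q + x₀`.

Let `w` be the element of least norm in the closure `D` of `Q(K) - x₀`. It is the infimal
displacement vector: for `z ∈ K` the displacement is exactly `Q z - x₀`, so `w` lies in the closure
of the displacements, while the `Nᗮ`-component of every displacement lies in `D`, so that
`⟪w, z - T₂ z⟫ ≥ ‖w‖²` (`norm_sq_le_inner_displacement`), which makes `w` the only possible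
element of least norm.

`T₂` is firmly nonexpansive, because the inner product of the differences of `T₂` and of `I - T₂`
reduces to `⟪p - p', q - q'⟫ ≥ 0`. Hence the displacements along two orbits are asymptotically equal,
and their norms decrease along each orbit. Starting one orbit at a point of `K` whose displacement
is close to `w`, the inequality above keeps all its displacements close to `w`; this gives the
convergence (`tendsto_displacement`).

The remaining claims follow from `⟪w, d⟫ ≥ ‖w‖²` for `d ∈ D`. As `K` is a cone, this yields
`⟪w, k⟫ ≥ 0` on `K` and `⟪w, x₀⟫ ≤ -‖w‖²`, that is, the separation; and `‖w‖` is the distance of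
`K` from `x₀ + N`, the affine set.
-/

namespace ConicDRS

/-! ### Projections onto closed convex sets -/

section Projection

variable {n : ℕ} {C : Set (EuclideanSpace ℝ (Fin n))}

theorem IsNearestPoint.inner_le_zero (hC : Convex ℝ C) {x p : EuclideanSpace ℝ (Fin n)}
    (hp : IsNearestPoint C x p) {y : EuclideanSpace ℝ (Fin n)} (hy : y ∈ C) :
    inner ℝ (x - p) (y - p) ≤ 0 := by
  refine (norm_eq_iInf_iff_real_inner_le_zero hC hp.1).1 ?_ y hy
  have : Nonempty C := ⟨⟨p, hp.1⟩⟩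
  refine le_antisymm (le_ciInf fun c => ?_)
    (ciInf_le ⟨0, by rintro _ ⟨c, rfl⟩; exact norm_nonneg _⟩ (⟨p, hp.1⟩ : C))
  rw [norm_sub_rev x p, norm_sub_rev x]
  exact hp.2 c c.2

theorem proj_eq_self {x : EuclideanSpace ℝ (Fin n)} (hC : IsClosed C) (hconv : Convex ℝ C)
    (hx : x ∈ C) : proj C x = x :=
  (IsNearestPoint.eq_proj hC hconv ⟨hx, fun y _ => by simp⟩).symm

theorem proj_submodule (S : Submodule ℝ (EuclideanSpace ℝ (Fin n)))
    (x : EuclideanSpace ℝ (Fin n)) : proj (S : Set _) x = S.starProjection x := by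
  refine (IsNearestPoint.eq_proj S.closed_of_finiteDimensional S.convex
    ⟨S.starProjection_apply_mem x, fun y hy => ?_⟩).symm
  rw [norm_sub_rev, norm_sub_rev y, S.starProjection_minimal]
  exact ciInf_le ⟨0, by rintro _ ⟨c, rfl⟩; exact norm_nonneg _⟩ (⟨y, hy⟩ : S)

/-- The projection onto a closed convex set is firmly nonexpansive. -/
theorem inner_proj_sub_nonneg (hne : C.Nonempty) (hC : IsClosed C) (hconv : Convex ℝ C)
    (x y : EuclideanSpace ℝ (Fin n)) :
    0 ≤ inner ℝ (proj C x - proj C y) ((x - proj C x) - (y - proj C y)) := by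
  have hx := isNearestPoint_proj hne hC x
  have hy := isNearestPoint_proj hne hC y
  have h1 := hx.inner_le_zero hconv hy.1
  have h2 := hy.inner_le_zero hconv hx.1
  rw [inner_sub_right, real_inner_comm, real_inner_comm (y - proj C y)]
  rw [← neg_sub (proj C x) (proj C y), inner_neg_right] at h1
  linarith

end Projection

/-! ### Orbits of firmly nonexpansive maps -/

section FirmlyNonexpansive

variable {E : Type*} [NormedAddCommGroup E] {T : E → E}

/-- Along two orbits of a firmly nonexpansive map the displacements are asymptotically equal. -/
theorem tendsto_displacement_sub
    (hT : ∀ x y, ‖T x - T y‖ ^ 2 + ‖(x - T x) - (y - T y)‖ ^ 2 ≤ ‖x - y‖ ^ 2)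
    {x y : ℕ → E} (hx : ∀ k, x (k + 1) = T (x k)) (hy : ∀ k, y (k + 1) = T (y k)) :
    Tendsto (fun k => (x k - x (k + 1)) - (y k - y (k + 1))) atTop (𝓝 0) := by
  have hstep : ∀ k, ‖(x k - x (k + 1)) - (y k - y (k + 1))‖ ^ 2
      ≤ ‖x k - y k‖ ^ 2 - ‖x (k + 1) - y (k + 1)‖ ^ 2 := fun k => by
    rw [hx, hy]; linarith [hT (x k) (y k)]
  -- The bounds telescope, so the squared differences of the displacements are summable.
  have hsum : Summable fun k => ‖(x k - x (k + 1)) - (y k - y (k + 1))‖ ^ 2 := by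
    refine summable_of_sum_range_le (c := ‖x 0 - y 0‖ ^ 2) (fun k => sq_nonneg _) fun k => ?_
    calc _ ≤ ∑ i ∈ Finset.range k, (‖x i - y i‖ ^ 2 - ‖x (i + 1) - y (i + 1)‖ ^ 2) :=
          Finset.sum_le_sum fun i _ => hstep i
      _ = ‖x 0 - y 0‖ ^ 2 - ‖x k - y k‖ ^ 2 :=
          Finset.sum_range_sub' (fun i => ‖x i - y i‖ ^ 2) k
      _ ≤ _ := by linarith [sq_nonneg ‖x k - y k‖]
  have h := hsum.tendsto_atTop_zero.sqrt
  simp only [Real.sqrt_sq (norm_nonneg _), Real.sqrt_zero] at h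
  exact tendsto_zero_iff_norm_tendsto_zero.2 h

theorem norm_displacement_le
    (hT : ∀ x y, ‖T x - T y‖ ^ 2 + ‖(x - T x) - (y - T y)‖ ^ 2 ≤ ‖x - y‖ ^ 2)
    {y : ℕ → E} (hy : ∀ k, y (k + 1) = T (y k)) (k : ℕ) :
    ‖y k - y (k + 1)‖ ≤ ‖y 0 - y 1‖ := by
  refine antitone_nat_of_succ_le (f := fun k => ‖y k - y (k + 1)‖) (fun k => ?_) (Nat.zero_le k)
  have h := hT (y k) (y (k + 1))
  rw [← hy, ← hy] at h
  refine (sq_le_sq₀ (norm_nonneg _) (norm_nonneg _)).1 ?_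
  linarith [sq_nonneg ‖(y k - y (k + 1)) - (y (k + 1) - y (k + 1 + 1))‖]

end FirmlyNonexpansive

/-! ### The null space and its orthogonal complement -/

section NullSpace

variable {m n : ℕ} (A : Matrix (Fin m) (Fin n) ℝ) (b : EuclideanSpace ℝ (Fin m))

/-- The null space of `A` as a linear subspace. -/
def nullSubmodule : Submodule ℝ (EuclideanSpace ℝ (Fin n)) where
  carrier := nullSpace A
  add_mem' {x y} hx hy := by
    simp only [nullSpace, Set.mem_ofPred_eq] at hx hy ⊢
    rw [WithLp.ofLp_add, Matrix.mulVec_add, hx, hy, add_zero]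
  zero_mem' := by simp [nullSpace]
  smul_mem' c x hx := by
    simp only [nullSpace, Set.mem_ofPred_eq] at hx ⊢
    rw [WithLp.ofLp_smul, Matrix.mulVec_smul, hx, smul_zero]

variable {A} {b}

theorem mem_nullSubmodule {x : EuclideanSpace ℝ (Fin n)} :
    x ∈ nullSubmodule A ↔ A.mulVec x.ofLp = 0 := Iff.rfl

theorem isUnit_det_mul_transpose (hA : A.rank = m) : IsUnit (A * A.transpose).det := by
  rw [← Matrix.isUnit_iff_isUnit_det, ← Matrix.mulVec_surjective_iff_isUnit]
  have h : Module.finrank ℝ (LinearMap.range (A * A.transpose).mulVecLin) = m :=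
    (Matrix.rank_self_mul_transpose A).trans hA
  exact LinearMap.range_eq_top.1 (Submodule.eq_top_of_finrank_eq
    (h.trans (Module.finrank_fin_fun ℝ).symm))

theorem rangeTranspose_subset : rangeTranspose A ⊆ (nullSubmodule A)ᗮ := by
  rintro x ⟨u, hu⟩ y hy
  rw [EuclideanSpace.inner_eq_star_dotProduct, ← hu, star_trivial, Matrix.mulVec_transpose,
    ← Matrix.dotProduct_mulVec, mem_nullSubmodule.1 hy, dotProduct_zero]

theorem x0_mem_rangeTranspose : x0 A b ∈ rangeTranspose A :=
  ⟨(A * A.transpose)⁻¹.mulVec b.ofLp, by simp [x0, Matrix.mulVec_mulVec]⟩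

theorem x0_mem_orthogonal : x0 A b ∈ (nullSubmodule A)ᗮ :=
  rangeTranspose_subset x0_mem_rangeTranspose

theorem mulVec_x0 (hA : A.rank = m) : A.mulVec (x0 A b).ofLp = b.ofLp := by
  simp only [x0, Matrix.mulVec_mulVec]
  rw [← Matrix.mul_assoc, Matrix.mul_nonsing_inv _ (isUnit_det_mul_transpose hA),
    Matrix.one_mulVec]

theorem mem_affineSet_iff (hA : A.rank = m) {y : EuclideanSpace ℝ (Fin n)} :
    y ∈ affineSet A b ↔ y - x0 A b ∈ nullSubmodule A := by
  rw [mem_nullSubmodule, WithLp.ofLp_sub, Matrix.mulVec_sub, mulVec_x0 hA, sub_eq_zero]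
  rfl

theorem orthogonal_subset_rangeTranspose (hA : A.rank = m) {x : EuclideanSpace ℝ (Fin n)}
    (hx : x ∈ (nullSubmodule A)ᗮ) : x ∈ rangeTranspose A := by
  -- `x - Aᵀ(AAᵀ)⁻¹Ax` lies both in the null space and in its orthogonal complement.
  set y := x0 A (WithLp.toLp 2 (A.mulVec x.ofLp))
  have h1 : x - y ∈ nullSubmodule A := (mem_affineSet_iff hA).1 rfl
  have h2 : x - y ∈ (nullSubmodule A)ᗮ := Submodule.sub_mem _ hx x0_mem_orthogonal
  have h3 : x = y := sub_eq_zero.1 (inner_self_eq_zero.1 (h2 _ h1))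
  rw [h3]
  exact x0_mem_rangeTranspose

end NullSpace

/-- Exchanging the roles of a subspace and its orthogonal complement turns `(p, q)` into two vectors
with the same inner product. -/
theorem inner_starProjection_cross {E : Type*} [NormedAddCommGroup E] [InnerProductSpace ℝ E]
    (S : Submodule ℝ E) [S.HasOrthogonalProjection] (p q : E) :
    inner ℝ (S.starProjection p + Sᗮ.starProjection q)
      (Sᗮ.starProjection p + S.starProjection q) = inner ℝ p q := by
  have h : ∀ x y, inner ℝ (S.starProjection x) (Sᗮ.starProjection y) = 0 := fun x y =>
    Sᗮ.starProjection_apply_mem y _ (S.starProjection_apply_mem x)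
  have h' : ∀ x y, inner ℝ (Sᗮ.starProjection x) (S.starProjection y) = 0 := fun x y => by
    rw [real_inner_comm, h]
  conv_rhs => rw [← S.starProjection_add_starProjection_orthogonal p,
    ← S.starProjection_add_starProjection_orthogonal q]
  simp only [inner_add_left, inner_add_right, h, h',
    real_inner_comm (Sᗮ.starProjection p) (Sᗮ.starProjection q)]
  ring

/-! ### The operator and its displacements -/

section Operator

variable {m n : ℕ} {K : Set (EuclideanSpace ℝ (Fin n))} {A : Matrix (Fin m) (Fin n) ℝ}
  {b : EuclideanSpace ℝ (Fin m)}

theorem T2_eq (z : EuclideanSpace ℝ (Fin n)) :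
    T2 K A b z = (nullSubmodule A).starProjection (proj K z)
      + (nullSubmodule A)ᗮ.starProjection (z - proj K z) + x0 A b := by
  have h : proj (nullSpace A) = (nullSubmodule A).starProjection :=
    funext (proj_submodule (nullSubmodule A))
  simp only [T2, Ttilde, refl, h, Submodule.starProjection_orthogonal_val, map_sub, map_smul]
  module

theorem displacement_eq (z : EuclideanSpace ℝ (Fin n)) :
    z - T2 K A b z = (nullSubmodule A)ᗮ.starProjection (proj K z)
      + (nullSubmodule A).starProjection (z - proj K z) - x0 A b := by
  rw [T2_eq]
  simp only [Submodule.starProjection_orthogonal_val, map_sub]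
  module

theorem T2_firmlyNonexpansive (hne : K.Nonempty) (hC : IsClosed K) (hconv : Convex ℝ K)
    (x y : EuclideanSpace ℝ (Fin n)) :
    ‖T2 K A b x - T2 K A b y‖ ^ 2 + ‖(x - T2 K A b x) - (y - T2 K A b y)‖ ^ 2
      ≤ ‖x - y‖ ^ 2 := by
  have h := inner_proj_sub_nonneg hne hC hconv x y
  rw [← inner_starProjection_cross (nullSubmodule A)] at h
  have h1 : T2 K A b x - T2 K A b y =
      (nullSubmodule A).starProjection (proj K x - proj K y)
      + (nullSubmodule A)ᗮ.starProjection ((x - proj K x) - (y - proj K y)) := by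
    rw [T2_eq, T2_eq]; simp only [map_sub]; abel
  have h2 : (x - T2 K A b x) - (y - T2 K A b y) =
      (nullSubmodule A)ᗮ.starProjection (proj K x - proj K y)
      + (nullSubmodule A).starProjection ((x - proj K x) - (y - proj K y)) := by
    rw [displacement_eq, displacement_eq]; simp only [map_sub]; abel
  rw [← h1, ← h2] at h
  have h3 : x - y = (T2 K A b x - T2 K A b y) + ((x - T2 K A b x) - (y - T2 K A b y)) := by abel
  rw [h3, norm_add_sq_real]
  linarith

variable (K A b) in
/-- The closure of `Q(K) - x₀`, where `Q` is the projection onto the orthogonal complement of the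
null space: the closure of the `Q`-components of the differences `x - y` with `x ∈ K`, `A y = b`. -/
noncomputable def gapSet : Set (EuclideanSpace ℝ (Fin n)) :=
  closure ((fun k => (nullSubmodule A)ᗮ.starProjection k - x0 A b) '' K)

variable (K A b) in
/-- The element of least norm in `gapSet K A b`. -/
noncomputable def gapVector : EuclideanSpace ℝ (Fin n) := proj (gapSet K A b) 0

theorem sub_mem_gapSet {k : EuclideanSpace ℝ (Fin n)} (hk : k ∈ K) :
    (nullSubmodule A)ᗮ.starProjection k - x0 A b ∈ gapSet K A b :=
  subset_closure ⟨k, hk, rfl⟩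

theorem convex_gapSet (hconv : Convex ℝ K) : Convex ℝ (gapSet K A b) := by
  refine Convex.closure ?_
  simp only [sub_eq_add_neg]
  have h := (hconv.is_linear_image (f := (nullSubmodule A)ᗮ.starProjection)
    ((nullSubmodule A)ᗮ.starProjection.isLinear)).translate (-(x0 A b))
  rw [Set.image_image] at h
  simpa only [add_comm] using h

theorem isNearestPoint_gapVector (hne : K.Nonempty) :
    IsNearestPoint (gapSet K A b) 0 (gapVector K A b) :=
  isNearestPoint_proj (hne.image _).closure isClosed_closure 0

theorem gapVector_mem_orthogonal (hne : K.Nonempty) :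
    gapVector K A b ∈ (nullSubmodule A)ᗮ := by
  refine closure_minimal ?_ (nullSubmodule A)ᗮ.closed_of_finiteDimensional
    (isNearestPoint_gapVector hne).1
  rintro _ ⟨k, -, rfl⟩
  exact Submodule.sub_mem _ (Submodule.starProjection_apply_mem _ _) x0_mem_orthogonal

theorem norm_sq_le_inner_gapSet (hne : K.Nonempty) (hconv : Convex ℝ K)
    {d : EuclideanSpace ℝ (Fin n)} (hd : d ∈ gapSet K A b) :
    ‖gapVector K A b‖ ^ 2 ≤ inner ℝ (gapVector K A b) d := by
  have h := (isNearestPoint_gapVector hne).inner_le_zero (convex_gapSet hconv) hd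
  rw [zero_sub, inner_neg_left, inner_sub_right, real_inner_self_eq_norm_sq] at h
  linarith

theorem norm_sq_le_inner_sub (hne : K.Nonempty) (hconv : Convex ℝ K)
    {k : EuclideanSpace ℝ (Fin n)} (hk : k ∈ K) :
    ‖gapVector K A b‖ ^ 2 ≤
      inner ℝ (gapVector K A b) k - inner ℝ (gapVector K A b) (x0 A b) := by
  have h := norm_sq_le_inner_gapSet hne hconv (sub_mem_gapSet (A := A) (b := b) hk)
  rwa [inner_sub_right, ← Submodule.inner_starProjection_left_eq_right,
    Submodule.starProjection_eq_self_iff.2 (gapVector_mem_orthogonal hne)] at h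

/-- The component of a displacement orthogonal to the null space lies in `gapSet`, and `gapVector`
is orthogonal to the other component. -/
theorem norm_sq_le_inner_displacement (hne : K.Nonempty) (hC : IsClosed K) (hconv : Convex ℝ K)
    (z : EuclideanSpace ℝ (Fin n)) :
    ‖gapVector K A b‖ ^ 2 ≤ inner ℝ (gapVector K A b) (z - T2 K A b z) := by
  have h := norm_sq_le_inner_gapSet hne hconv
    (sub_mem_gapSet (A := A) (b := b) (isNearestPoint_proj hne hC z).1)
  have h0 : inner ℝ (gapVector K A b)
      ((nullSubmodule A).starProjection (z - proj K z)) = (0 : ℝ) := by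
    rw [real_inner_comm]
    exact gapVector_mem_orthogonal hne _ (Submodule.starProjection_apply_mem _ _)
  rw [displacement_eq, inner_sub_right, inner_add_right, h0, add_zero, ← inner_sub_right]
  exact h

/-- An upper bound on the norm of a displacement bounds its distance to `gapVector`. -/
theorem norm_displacement_sub_sq_le (hne : K.Nonempty) (hC : IsClosed K) (hconv : Convex ℝ K)
    (z : EuclideanSpace ℝ (Fin n)) :
    ‖(z - T2 K A b z) - gapVector K A b‖ ^ 2 ≤
      ‖z - T2 K A b z‖ ^ 2 - ‖gapVector K A b‖ ^ 2 := by
  rw [norm_sub_sq_real, real_inner_comm]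
  linarith [norm_sq_le_inner_displacement (A := A) (b := b) hne hC hconv z]

theorem displacement_of_mem (hC : IsClosed K) (hconv : Convex ℝ K)
    {k : EuclideanSpace ℝ (Fin n)} (hk : k ∈ K) :
    k - T2 K A b k = (nullSubmodule A)ᗮ.starProjection k - x0 A b := by
  rw [displacement_eq, proj_eq_self hC hconv hk, sub_self, map_zero, add_zero]

theorem gapSet_subset_closure_range (hC : IsClosed K) (hconv : Convex ℝ K) :
    gapSet K A b ⊆ closure (Set.range fun z => z - T2 K A b z) := by
  refine closure_mono ?_
  rintro _ ⟨k, hk, rfl⟩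
  exact ⟨k, displacement_of_mem hC hconv hk⟩

/-- The infimal displacement vector is the element of least norm in `gapSet`. The convexity of the
closure of the range of `I - T₂` is not needed: the inner product bound already shows that
`gapVector` is its only element of least norm. -/
theorem infimalDisplacement_eq (hne : K.Nonempty) (hC : IsClosed K) (hconv : Convex ℝ K) :
    infimalDisplacement (T2 K A b) = gapVector K A b := by
  set w := gapVector K A b
  have hw : w ∈ closure (Set.range fun z => z - T2 K A b z) :=
    gapSet_subset_closure_range hC hconv (isNearestPoint_gapVector hne).1
  have hv := isNearestPoint_proj ⟨w, hw⟩ isClosed_closure 0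
  set v := proj (closure (Set.range fun z => z - T2 K A b z)) 0
  have h1 : ‖w‖ ^ 2 ≤ inner ℝ w v := by
    refine closure_minimal (t := {u | ‖w‖ ^ 2 ≤ inner ℝ w u}) ?_
      (isClosed_le continuous_const (by fun_prop)) hv.1
    rintro _ ⟨z, rfl⟩
    exact norm_sq_le_inner_displacement hne hC hconv z
  have h2 : ‖v‖ ≤ ‖w‖ := by simpa using hv.2 w hw
  have h3 : ‖v - w‖ ^ 2 ≤ 0 := by
    rw [norm_sub_sq_real, real_inner_comm]
    nlinarith [norm_nonneg v]
  have h4 : ‖v - w‖ = 0 := sq_eq_zero_iff.1 (le_antisymm h3 (sq_nonneg _))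
  exact sub_eq_zero.1 (norm_eq_zero.1 h4)

/-- The displacements along every orbit converge to `gapVector`. -/
theorem tendsto_displacement (hne : K.Nonempty) (hC : IsClosed K) (hconv : Convex ℝ K)
    {z : ℕ → EuclideanSpace ℝ (Fin n)} (hz : ∀ k, z (k + 1) = T2 K A b (z k)) :
    Tendsto (fun k => z k - z (k + 1)) atTop (𝓝 (gapVector K A b)) := by
  set w := gapVector K A b
  rw [Metric.tendsto_atTop]
  intro ε hε
  -- A point of `K` whose displacement has almost least norm.
  obtain ⟨_, ⟨y₀, hy₀, rfl⟩, hlt⟩ :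
      ∃ d ∈ (fun k => (nullSubmodule A)ᗮ.starProjection k - x0 A b) '' K,
      ‖d‖ ^ 2 < ‖w‖ ^ 2 + (ε / 2) ^ 2 := by
    have ho : IsOpen {d : EuclideanSpace ℝ (Fin n) | ‖d‖ ^ 2 < ‖w‖ ^ 2 + (ε / 2) ^ 2} :=
      isOpen_lt (by fun_prop) continuous_const
    have hw : w ∈ {d : EuclideanSpace ℝ (Fin n) | ‖d‖ ^ 2 < ‖w‖ ^ 2 + (ε / 2) ^ 2} :=
      lt_add_of_pos_right (‖w‖ ^ 2) (pow_pos (half_pos hε) 2)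
    obtain ⟨d, hd, hdK⟩ := mem_closure_iff.1 (isNearestPoint_gapVector hne).1 _ ho hw
    exact ⟨d, hdK, hd⟩
  simp only [← displacement_of_mem hC hconv hy₀] at hlt
  have hT := T2_firmlyNonexpansive (A := A) (b := b) hne hC hconv
  let y : ℕ → EuclideanSpace ℝ (Fin n) := fun k => (T2 K A b)^[k] y₀
  have hy : ∀ k, y (k + 1) = T2 K A b (y k) := fun k => Function.iterate_succ_apply' _ _ _
  have hclose : ∀ k, ‖(y k - y (k + 1)) - w‖ < ε / 2 := fun k => by
    refine lt_of_pow_lt_pow_left₀ 2 (by positivity) ?_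
    have h1 := norm_displacement_sub_sq_le (A := A) (b := b) hne hC hconv (y k)
    have h2 := pow_le_pow_left₀ (norm_nonneg _) (norm_displacement_le hT hy k) 2
    have h3 : y 0 - y 1 = y₀ - T2 K A b y₀ := rfl
    rw [h3] at h2
    rw [← hy] at h1
    linarith
  obtain ⟨M, hM⟩ :=
    Metric.tendsto_atTop.1 (tendsto_displacement_sub hT hz hy) (ε / 2) (half_pos hε)
  refine ⟨M, fun k hk => ?_⟩
  have h1 := hM k hk
  rw [dist_zero_right] at h1
  rw [dist_eq_norm]
  calc _ = ‖((z k - z (k + 1)) - (y k - y (k + 1))) + ((y k - y (k + 1)) - w)‖ := by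
        congr 1; abel
    _ ≤ _ := norm_add_le _ _
    _ < ε := by linarith [hclose k]

end Operator

/-! ### Strong infeasibility and separation -/

section Separation

variable {m n : ℕ} {K : Set (EuclideanSpace ℝ (Fin n))} {A : Matrix (Fin m) (Fin n) ℝ}
  {b : EuclideanSpace ℝ (Fin m)}

theorem norm_gapVector_le (hne : K.Nonempty) (hA : A.rank = m)
    {x y : EuclideanSpace ℝ (Fin n)} (hx : x ∈ K) (hy : y ∈ affineSet A b) :
    ‖gapVector K A b‖ ≤ ‖x - y‖ := by
  have h := (isNearestPoint_gapVector (A := A) (b := b) hne).2 _ (sub_mem_gapSet hx)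
  have h1 : (nullSubmodule A)ᗮ.starProjection (x - y) =
      (nullSubmodule A)ᗮ.starProjection x - x0 A b := by
    have h2 := Submodule.starProjection_orthogonal_apply_eq_zero ((mem_affineSet_iff hA).1 hy)
    rw [map_sub, Submodule.starProjection_eq_self_iff.2 x0_mem_orthogonal, sub_eq_zero] at h2
    rw [map_sub, h2]
  rw [sub_zero, sub_zero, ← h1] at h
  exact h.trans (Submodule.norm_starProjection_apply_le _ _)

theorem isStronglyInfeasible_iff (hne : K.Nonempty) (hA : A.rank = m) :
    IsStronglyInfeasible K A b ↔ gapVector K A b ≠ 0 := by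
  constructor
  · -- A point `k` of `K` and the point `x₀ + P k` of the affine set differ by `Q k - x₀`.
    rintro ⟨-, hpos⟩ h0
    have hmem := (isNearestPoint_gapVector (A := A) (b := b) hne).1
    rw [h0] at hmem
    obtain ⟨_, ⟨k, hk, rfl⟩, hd⟩ := Metric.mem_closure_iff.1 hmem _ hpos
    rw [dist_zero_left] at hd
    refine hd.not_ge (csInf_le ⟨0, ?_⟩ ⟨k, hk, x0 A b + (nullSubmodule A).starProjection k, ?_, ?_⟩)
    · rintro _ ⟨x, -, y, -, rfl⟩
      exact norm_nonneg _
    · rw [mem_affineSet_iff hA, add_sub_cancel_left]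
      exact Submodule.starProjection_apply_mem _ _
    · beta_reduce
      rw [Submodule.starProjection_orthogonal_val]
      congr 1
      abel
  · intro h0
    have hpos : 0 < ‖gapVector K A b‖ := norm_pos_iff.2 h0
    refine ⟨Set.eq_empty_of_forall_notMem fun x hx => ?_, hpos.trans_le (le_csInf ?_ ?_)⟩
    · have h := norm_gapVector_le hne hA hx.1 hx.2
      rw [sub_self, norm_zero] at h
      exact hpos.not_ge h
    · obtain ⟨k, hk⟩ := hne
      exact ⟨_, k, hk, x0 A b, mulVec_x0 hA, rfl⟩
    · rintro _ ⟨x, hx, y, hy, rfl⟩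
      exact norm_gapVector_le hne hA hx hy

theorem IsCone.smul_mem (hcone : IsCone K) {t : ℝ} (ht : 0 < t) {k : EuclideanSpace ℝ (Fin n)}
    (hk : k ∈ K) : t • k ∈ K :=
  (hcone t ht).subset ⟨k, hk, rfl⟩

theorem gapVector_mem_dualCone (hne : K.Nonempty) (hconv : Convex ℝ K) (hcone : IsCone K) :
    gapVector K A b ∈ dualCone K := by
  intro k hk
  by_contra! hneg
  set c := inner ℝ (gapVector K A b) (x0 A b)
  -- Scaling `k` by this factor makes `⟪w, t • k⟫` at most `c - 1`.
  have ht : 0 < (|c| + 1) / -inner ℝ (gapVector K A b) k :=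
    div_pos (by positivity) (neg_pos.2 hneg)
  have h := norm_sq_le_inner_sub (A := A) (b := b) hne hconv (hcone.smul_mem ht hk)
  rw [inner_smul_right, div_mul_eq_mul_div, div_neg, mul_div_cancel_right₀ _ hneg.ne] at h
  linarith [neg_abs_le c, sq_nonneg ‖gapVector K A b‖]

theorem inner_gapVector_x0_le (hne : K.Nonempty) (hconv : Convex ℝ K) (hcone : IsCone K) :
    inner ℝ (gapVector K A b) (x0 A b) ≤ -‖gapVector K A b‖ ^ 2 := by
  obtain ⟨k, hk⟩ := hne
  -- Let `t` tend to `0` in the inequality for the points `t • k` of the cone.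
  have hlim : Tendsto (fun t : ℝ => t * inner ℝ (gapVector K A b) k
      - inner ℝ (gapVector K A b) (x0 A b)) (𝓝[>] 0)
      (𝓝 (0 * inner ℝ (gapVector K A b) k - inner ℝ (gapVector K A b) (x0 A b))) :=
    tendsto_nhdsWithin_of_tendsto_nhds (Continuous.tendsto (by fun_prop) 0)
  have h := ge_of_tendsto hlim (b := ‖gapVector K A b‖ ^ 2) (by
    filter_upwards [self_mem_nhdsWithin] with t ht
    have h := norm_sq_le_inner_sub (A := A) (b := b) ⟨k, hk⟩ hconv (hcone.smul_mem ht hk)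
    rwa [inner_smul_right] at h)
  linarith

theorem inner_gapVector_of_mem_affineSet (hne : K.Nonempty) (hA : A.rank = m)
    {y : EuclideanSpace ℝ (Fin n)} (hy : y ∈ affineSet A b) :
    inner ℝ (gapVector K A b) y = inner ℝ (gapVector K A b) (x0 A b) := by
  have h := gapVector_mem_orthogonal (A := A) (b := b) hne _ ((mem_affineSet_iff hA).1 hy)
  rw [real_inner_comm, inner_sub_right] at h
  linarith

end Separation

end ConicDRS

theorem mainTheorem3 {m n : ℕ} (K : Set (EuclideanSpace ℝ (Fin n)))
    (hKne : K.Nonempty) (hKclosed : IsClosed K) (hKconv : Convex ℝ K) (hKcone : ConicDRS.IsCone K)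
    (A : Matrix (Fin m) (Fin n) ℝ) (hA : A.rank = m) (b : EuclideanSpace ℝ (Fin m))
    (z : ℕ → EuclideanSpace ℝ (Fin n)) (hz : ∀ k, z (k + 1) = ConicDRS.T2 K A b (z k))
    (v h : EuclideanSpace ℝ (Fin n)) (β : ℝ)
    (hv : v = ConicDRS.infimalDisplacement (ConicDRS.T2 K A b))
    (hh : h = -v) (hβ : β = -(inner ℝ v (ConicDRS.x0 A b)) / 2) :
    Tendsto (fun k => z k - z (k + 1)) atTop (𝓝 v) ∧
    (ConicDRS.IsStronglyInfeasible K A b ↔ v ≠ 0) ∧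
    -h ∈ ConicDRS.dualCone K ∩ ConicDRS.rangeTranspose A ∧
    (ConicDRS.IsStronglyInfeasible K A b →
      0 < β ∧
      ∀ y₁ ∈ K, ∀ y₂ ∈ ConicDRS.affineSet A b, inner ℝ h y₁ < β ∧ β < inner ℝ h y₂) := by
  rw [ConicDRS.infimalDisplacement_eq hKne hKclosed hKconv] at hv
  subst hv hh hβ
  refine ⟨ConicDRS.tendsto_displacement hKne hKclosed hKconv hz,
    ConicDRS.isStronglyInfeasible_iff hKne hA, ?_, fun hinf => ?_⟩
  · rw [neg_neg]
    exact ⟨ConicDRS.gapVector_mem_dualCone hKne hKconv hKcone,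
      ConicDRS.orthogonal_subset_rangeTranspose hA (ConicDRS.gapVector_mem_orthogonal hKne)⟩
  · have hpos := norm_pos_iff.2 ((ConicDRS.isStronglyInfeasible_iff hKne hA).1 hinf)
    have hx0 := ConicDRS.inner_gapVector_x0_le (A := A) (b := b) hKne hKconv hKcone
    have hsq := pow_pos hpos 2
    refine ⟨by linarith, fun y₁ h₁ y₂ h₂ => ?_⟩
    have hd := ConicDRS.gapVector_mem_dualCone (A := A) (b := b) hKne hKconv hKcone y₁ h₁
    have ha := ConicDRS.inner_gapVector_of_mem_affineSet hKne hA h₂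
    rw [inner_neg_left, inner_neg_left, ha]
    exact ⟨by linarith, by linarith⟩
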